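/- **Theorem.** Consider the suspension calculus (with graftable meta variables). Its pre-syntax consists of terms $t ::= v \mid c \mid \#i \mid (t\ t) \mid (\lambda\, t) \mid [\![t,ol,nl,e]\!]$ and environments $e ::= nil \mid (t,l)::e \mid \{\!\{e_1,nl_1,ol_2,e_2\}\!\}$, where $v$ ranges over meta variables, $c$ over constants, $i\ge 1$, and $ol,nl,l,nl_1,ol_2\in\mathbb N$. Write $a\mathbin{\dot-}b=\max(a-b,0)$ and put $len(nil)=0$, $len((t,n)::e)=1+len(e)$, $len(\{\!\{e_1,nl_1,ol_2,e_2\}\!\})=len(e_1)+(ol_2\mathbin{\dot-}nl_1)$; $lev(nil)=0$, $lev((t,n)::e)=n$, $lev(\{\!\{e_1,nl_1,ol_2,e_2\}\!\})=lev(e_2)+(nl_1\mathbin{\dot-}ol_2)$. An expression is *well-formed* if every subexpression $[\![t,ol,nl,e]\!]$ satisfies $len(e)=ol$ and $lev(e)\le nl$, every subexpression $\{\!\{e_1,nl_1,ol_2,e_2\}\!\}$ satisfies $len(e_2)=ol_2$ and $lev(e_1)\le nl_1$, and every subexpression $(t,n)::e$ satisfies $lev(e)\le n$. The relation $\rhd_{rm}$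 is rewriting of any subexpression by one of the reading rules - (r1) $[\![c,ol,nl,e]\!]\to c$; - (r2) $[\![\#i,0,nl,nil]\!]\to\#(i+nl)$; - (r3) $[\![\#1,ol,nl,(t,l)::e]\!]\to[\![t,0,nl-l,nil]\!]$; - (r4) $[\![\#i,ol,nl,(t,l)::e]\!]\to[\![\#(i-1),ol-1,nl,e]\!]$ if $i>1$; - (r5) $[\![(t_1\ t_2),ol,nl,e]\!]\to([\![t_1,ol,nl,e]\!]\ [\![t_2,ol,nl,e]\!])$; - (r6) $[\![(\lambda\,t),ol,nl,e]\!]\to(\lambda\,[\![t,ol+1,nl+1,(\#1,nl+1)::e]\!])$ or merging rules - (m1) $[\![[\![t,ol_1,nl_1,e_1]\!],ol_2,nl_2,e_2]\!]\to[\![t,ol_1+(ol_2\mathbin{\dot-}nl_1),nl_2+(nl_1\mathbin{\dot-}ol_2),\{\!\{e_1,nl_1,ol_2,e_2\}\!\}]\!]$; - (m2) $\{\!\{e_1,nl_1,0,nil\}\!\}\to e_1$; - (m3) $\{\!\{nil,0,ol_2,e_2\}\!\}\to e_2$; - (m4) $\{\!\{nil,nl_1,ol_2,(t,l)::e_2\}\!\}\to\{\!\{nil,nl_1-1,ol_2-1,e_2\}\!\}$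 if $nl_1\ge1$; - (m5) $\{\!\{(t,n)::e_1,nl_1,ol_2,(s,l)::e_2\}\!\}\to\{\!\{(t,n)::e_1,nl_1-1,ol_2-1,e_2\}\!\}$ if $nl_1>n$; - (m6) $\{\!\{(t,n)::e_1,n,ol_2,(s,l)::e_2\}\!\}\to([\![t,ol_2,l,(s,l)::e_2]\!],\,l+(n\mathbin{\dot-}ol_2))::\{\!\{e_1,n,ol_2,(s,l)::e_2\}\!\}$; and $\rhd_{rm}^*$ is its reflexive and transitive closure. *Similarity* $\sim$ is the least relation between terms, and between environments, that is reflexive, is compatible with application, abstraction, $[\![\cdot,ol,nl,\cdot]\!]$, $(\cdot,n)::\cdot$ and $\{\!\{\cdot,nl_1,ol_2,\cdot\}\!\}$ (with equal numerical components on both sides), and satisfies $$([\![t,ol,nl,r]\!],nl+k)::e\ \sim\ ([\![t',ol,nl',r']\!],nl'+k)::e'\quad\text{whenever } t\sim t',\ r\sim r',\ e\sim e',\ k\in\mathbb N.$$ A *de Bruijn term* is a term built only from constants, indices, application and abstraction; a *simple environment* is one of the form $(t_0,l_0)::\cdots::(t_{n-1},l_{n-1})::nil$ with $n\ge0$. Then: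 1. If $t,t'$ are well-formed terms without meta variables and $t\sim t'$, then there is a de Bruijn term $d$ (which is in particular $\rhd_{rm}$-normal) with $t\rhd_{rm}^* d$ and $t'\rhd_{rm}^* d$. 2. If $e,e'$ are well-formed environments (possibly containing meta variables) and $e\sim e'$, then there are simple environments $s,s'$ with $e\rhd_{rm}^* s$, $e'\rhd_{rm}^* s'$ and $s\sim s'$. -/

import Mathlib

namespace Susp

/-- The two syntactic categories of the suspension calculus: terms and environments. -/
inductive Kind where
  | tm
  | env

/-- Pre-syntax of suspension expressions over constants `C` and (graftable) meta variables `V`: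
`t ::= v | c | #i | (t t) | (λ t) | ⟦t, ol, nl, e⟧` and
`e ::= nil | (t, l) :: e | {{e₁, nl₁, ol₂, e₂}}`.
De Bruijn indices start at 1, and `var i` stands for the index `#(i+1)`. -/
inductive Exp (C V : Type*) : Kind → Type _ where
  | mvar (v : V) : Exp C V .tm
  | const (c : C) : Exp C V .tm
  | var (i : ℕ) : Exp C V .tm
  | app (t₁ t₂ : Exp C V .tm) : Exp C V .tm
  | lam (t : Exp C V .tm) : Exp C V .tm
  | susp (t : Exp C V .tm) (ol nl : ℕ) (e : Exp C V .env) : Exp C V .tm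
  | nil : Exp C V .env
  | cons (t : Exp C V .tm) (l : ℕ) (e : Exp C V .env) : Exp C V .env
  | merge (e₁ : Exp C V .env) (nl₁ ol₂ : ℕ) (e₂ : Exp C V .env) : Exp C V .env

/-- Suspension terms (pre-syntax). -/
abbrev Tm (C V : Type*) := Exp C V .tm

/-- Suspension environments (pre-syntax). -/
abbrev Env (C V : Type*) := Exp C V .env

namespace Exp

variable {C V : Type*}

/-- Length of an environment; `ol₂ - nl₁` is truncated subtraction. -/
def len : Env C V → ℕ
  | nil => 0
  | cons _ _ e => 1 + len e
  | merge e₁ nl₁ ol₂ _ => len e₁ + (ol₂ - nl₁)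

/-- Level of an environment; `nl₁ - ol₂` is truncated subtraction. -/
def lev : Env C V → ℕ
  | nil => 0
  | cons _ l _ => l
  | merge _ nl₁ ol₂ e₂ => lev e₂ + (nl₁ - ol₂)

/-- Well-formedness of a suspension expression (imposed on all its subexpressions). -/
def WF : {κ : Kind} → Exp C V κ → Prop
  | _, mvar _ => True
  | _, const _ => True
  | _, var _ => True
  | _, app t₁ t₂ => WF t₁ ∧ WF t₂
  | _, lam t => WF t
  | _, susp t ol nl e => WF t ∧ WF e ∧ len e = ol ∧ lev e ≤ nl
  | _, nil => True
  | _, cons t l e => WF t ∧ WF e ∧ lev e ≤ l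
  | _, merge e₁ nl₁ ol₂ e₂ => WF e₁ ∧ WF e₂ ∧ len e₂ = ol₂ ∧ lev e₁ ≤ nl₁

/-- No meta variable occurs in the expression. -/
def MetaFree : {κ : Kind} → Exp C V κ → Prop
  | _, mvar _ => False
  | _, const _ => True
  | _, var _ => True
  | _, app t₁ t₂ => MetaFree t₁ ∧ MetaFree t₂
  | _, lam t => MetaFree t
  | _, susp t _ _ e => MetaFree t ∧ MetaFree e
  | _, nil => True
  | _, cons t _ e => MetaFree t ∧ MetaFree e
  | _, merge e₁ _ _ e₂ => MetaFree e₁ ∧ MetaFree e₂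

/-- De Bruijn terms: `t ::= c | #i | (t t) | (λ t)`. -/
def IsDeBruijn : Tm C V → Prop
  | mvar _ => False
  | const _ => True
  | var _ => True
  | app t₁ t₂ => IsDeBruijn t₁ ∧ IsDeBruijn t₂
  | lam t => IsDeBruijn t
  | susp _ _ _ _ => False

/-- Simple environments: `(t₀, l₀) :: ⋯ :: (tₙ₋₁, lₙ₋₁) :: nil`, with `n` possibly zero. -/
def IsSimple : Env C V → Prop
  | nil => True
  | cons _ _ e => IsSimple e
  | merge _ _ _ _ => False

end Exp

open Exp

variable {C V : Type*}

/-- Instances of the reading rules (r1)-(r6). -/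
inductive ReadRule : Tm C V → Tm C V → Prop where
  | r1 (c : C) (ol nl : ℕ) (e : Env C V) :
      ReadRule (susp (const c) ol nl e) (const c)
  | r2 (i nl : ℕ) :
      ReadRule (susp (var i) 0 nl nil) (var (i + nl))
  | r3 (ol nl : ℕ) (t : Tm C V) (l : ℕ) (e : Env C V) :
      ReadRule (susp (var 0) ol nl (cons t l e)) (susp t 0 (nl - l) nil)
  | r4 (i ol nl : ℕ) (t : Tm C V) (l : ℕ) (e : Env C V) :
      ReadRule (susp (var (i + 1)) ol nl (cons t l e)) (susp (var i) (ol - 1) nl e)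
  | r5 (t₁ t₂ : Tm C V) (ol nl : ℕ) (e : Env C V) :
      ReadRule (susp (app t₁ t₂) ol nl e) (app (susp t₁ ol nl e) (susp t₂ ol nl e))
  | r6 (t : Tm C V) (ol nl : ℕ) (e : Env C V) :
      ReadRule (susp (lam t) ol nl e)
        (lam (susp t (ol + 1) (nl + 1) (cons (var 0) (nl + 1) e)))

/-- Instances of the merging rules (m1)-(m6). -/
inductive MergeRule : {κ : Kind} → Exp C V κ → Exp C V κ → Prop where
  | m1 (t : Tm C V) (ol₁ nl₁ : ℕ) (e₁ : Env C V) (ol₂ nl₂ : ℕ) (e₂ : Env C V) :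
      MergeRule (susp (susp t ol₁ nl₁ e₁) ol₂ nl₂ e₂)
        (susp t (ol₁ + (ol₂ - nl₁)) (nl₂ + (nl₁ - ol₂)) (merge e₁ nl₁ ol₂ e₂))
  | m2 (e₁ : Env C V) (nl₁ : ℕ) :
      MergeRule (merge e₁ nl₁ 0 nil) e₁
  | m3 (ol₂ : ℕ) (e₂ : Env C V) :
      MergeRule (merge nil 0 ol₂ e₂) e₂
  | m4 (nl₁ ol₂ : ℕ) (t : Tm C V) (l : ℕ) (e₂ : Env C V) (h : 1 ≤ nl₁) :
      MergeRule (merge nil nl₁ ol₂ (cons t l e₂)) (merge nil (nl₁ - 1) (ol₂ - 1) e₂)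
  | m5 (t : Tm C V) (n : ℕ) (e₁ : Env C V) (nl₁ ol₂ : ℕ) (s : Tm C V) (l : ℕ)
      (e₂ : Env C V) (h : n < nl₁) :
      MergeRule (merge (cons t n e₁) nl₁ ol₂ (cons s l e₂))
        (merge (cons t n e₁) (nl₁ - 1) (ol₂ - 1) e₂)
  | m6 (t : Tm C V) (n : ℕ) (e₁ : Env C V) (ol₂ : ℕ) (s : Tm C V) (l : ℕ) (e₂ : Env C V) :
      MergeRule (merge (cons t n e₁) n ol₂ (cons s l e₂))
        (cons (susp t ol₂ l (cons s l e₂)) (l + (n - ol₂))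
          (merge e₁ n ol₂ (cons s l e₂)))

/-- One step of reading and merging: a reading or merging rule applied to some subexpression. -/
inductive Step : {κ : Kind} → Exp C V κ → Exp C V κ → Prop where
  | read {t t' : Tm C V} (h : ReadRule t t') : Step t t'
  | merge {κ : Kind} {x x' : Exp C V κ} (h : MergeRule x x') : Step x x'
  | appLeft {t₁ t₁' : Tm C V} (t₂ : Tm C V) (h : Step t₁ t₁') :
      Step (app t₁ t₂) (app t₁' t₂)
  | appRight (t₁ : Tm C V) {t₂ t₂' : Tm C V} (h : Step t₂ t₂') :
      Step (app t₁ t₂) (app t₁ t₂')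
  | lamBody {t t' : Tm C V} (h : Step t t') : Step (lam t) (lam t')
  | suspTerm {t t' : Tm C V} (ol nl : ℕ) (e : Env C V) (h : Step t t') :
      Step (susp t ol nl e) (susp t' ol nl e)
  | suspEnv (t : Tm C V) (ol nl : ℕ) {e e' : Env C V} (h : Step e e') :
      Step (susp t ol nl e) (susp t ol nl e')
  | consHead {t t' : Tm C V} (l : ℕ) (e : Env C V) (h : Step t t') :
      Step (cons t l e) (cons t' l e)
  | consTail (t : Tm C V) (l : ℕ) {e e' : Env C V} (h : Step e e') :
      Step (cons t l e) (cons t l e')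
  | mergeLeft {e₁ e₁' : Env C V} (nl₁ ol₂ : ℕ) (e₂ : Env C V) (h : Step e₁ e₁') :
      Step (Exp.merge e₁ nl₁ ol₂ e₂) (Exp.merge e₁' nl₁ ol₂ e₂)
  | mergeRight (e₁ : Env C V) (nl₁ ol₂ : ℕ) {e₂ e₂' : Env C V} (h : Step e₂ e₂') :
      Step (Exp.merge e₁ nl₁ ol₂ e₂) (Exp.merge e₁ nl₁ ol₂ e₂')

/-- Rewriting by the reading and merging rules: the reflexive and transitive closure of `Step`. -/
abbrev Steps {κ : Kind} (x y : Exp C V κ) : Prop := Relation.ReflTransGen Step x y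

/-- The similarity relation. The last rule allows the embedding levels of a suspension at the head
of an environment to differ, provided the index of that environment term differs accordingly. -/
inductive Sim : {κ : Kind} → Exp C V κ → Exp C V κ → Prop where
  | refl {κ : Kind} (x : Exp C V κ) : Sim x x
  | app {t₁ t₁' t₂ t₂' : Tm C V} (h₁ : Sim t₁ t₁') (h₂ : Sim t₂ t₂') :
      Sim (app t₁ t₂) (app t₁' t₂')
  | lam {t t' : Tm C V} (h : Sim t t') : Sim (lam t) (lam t')
  | susp {t t' : Tm C V} (ol nl : ℕ) {e e' : Env C V} (ht : Sim t t') (he : Sim e e') :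
      Sim (susp t ol nl e) (susp t' ol nl e')
  | cons {t t' : Tm C V} (n : ℕ) {e e' : Env C V} (ht : Sim t t') (he : Sim e e') :
      Sim (cons t n e) (cons t' n e')
  | merge {e₁ e₁' : Env C V} (nl₁ ol₂ : ℕ) {e₂ e₂' : Env C V}
      (h₁ : Sim e₁ e₁') (h₂ : Sim e₂ e₂') :
      Sim (merge e₁ nl₁ ol₂ e₂) (merge e₁' nl₁ ol₂ e₂')
  | renumber {t t' : Tm C V} (ol nl nl' k : ℕ) {r r' e e' : Env C V}
      (ht : Sim t t') (hr : Sim r r') (he : Sim e e') :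
      Sim (Exp.cons (Exp.susp t ol nl r) (nl + k) e)
        (Exp.cons (Exp.susp t' ol nl' r') (nl' + k) e')

end Susp

namespace Susp

open Exp

variable {C V : Type*}

/-! ### Rewriting is a congruence -/

/-! Similar expressions differ only in how environment entries are numbered: replacing `nl` and `nl
+ k` by `nl'` and `nl' + k` leaves the gap `k` unchanged, and only such gaps affect what an entry
contributes. Both claims are proved by induction on similarity with an explicit rewriting strategy;
neither termination nor confluence is used.

For environments with meta variables the terms stay unevaluated and only merges are eliminated.
Merging into an entry of level `n` first deletes `N - n` entries of the second environment, so
differently numbered copies keep different suffixes. The sum of the level and the number of deleted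
entries is nevertheless the same on both sides. `SimpleSim.merge` carries this invariant and
rebuilds similarity with the renumbering clause.

Without meta variables, terms evaluate to de Bruijn terms, and an environment at level `nl` denotes
the simultaneous substitution `look s nl` (`susp_steps`). Entries are compared after lifting to a
common level. Equivalent environments denote the same substitution (`EnvEquiv.look_eq`), and merging
preserves equivalence (`EnvEquiv.mergeDB`), by the same invariant. -/

theorem Steps.app {t t' u u' : Tm C V} (h : Steps t t') (k : Steps u u') :
    Steps (app t u) (app t' u') :=
  (Relation.ReflTransGen.lift (fun x => Exp.app x u) (fun _ _ => Step.appLeft u) _ _ h).trans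
    (Relation.ReflTransGen.lift (fun x => Exp.app t' x) (fun _ _ => Step.appRight t') _ _ k)

theorem Steps.lam {t t' : Tm C V} (h : Steps t t') : Steps (lam t) (lam t') :=
  Relation.ReflTransGen.lift (fun x => Exp.lam x) (fun _ _ => Step.lamBody) _ _ h

theorem Steps.susp {t t' : Tm C V} {e e' : Env C V} (ol nl : ℕ) (h : Steps t t')
    (k : Steps e e') : Steps (susp t ol nl e) (susp t' ol nl e') :=
  (Relation.ReflTransGen.lift (fun x => Exp.susp x ol nl e)
      (fun _ _ => Step.suspTerm ol nl e) _ _ h).trans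
    (Relation.ReflTransGen.lift (fun x => Exp.susp t' ol nl x)
      (fun _ _ => Step.suspEnv t' ol nl) _ _ k)

theorem Steps.cons {t t' : Tm C V} {e e' : Env C V} (l : ℕ) (h : Steps t t')
    (k : Steps e e') : Steps (cons t l e) (cons t' l e') :=
  (Relation.ReflTransGen.lift (fun x => Exp.cons x l e)
      (fun _ _ => Step.consHead l e) _ _ h).trans
    (Relation.ReflTransGen.lift (fun x => Exp.cons t' l x)
      (fun _ _ => Step.consTail t' l) _ _ k)

theorem Steps.merge {e₁ e₁' e₂ e₂' : Env C V} (nl ol : ℕ) (h : Steps e₁ e₁')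
    (k : Steps e₂ e₂') : Steps (merge e₁ nl ol e₂) (merge e₁' nl ol e₂') :=
  (Relation.ReflTransGen.lift (fun x => Exp.merge x nl ol e₂)
      (fun _ _ => Step.mergeLeft nl ol e₂) _ _ h).trans
    (Relation.ReflTransGen.lift (fun x => Exp.merge e₁' nl ol x)
      (fun _ _ => Step.mergeRight e₁' nl ol) _ _ k)

theorem ReadRule.steps {t t' : Tm C V} (h : ReadRule t t') : Steps t t' := .single (.read h)

theorem MergeRule.steps {κ : Kind} {x x' : Exp C V κ} (h : MergeRule x x') : Steps x x' :=
  .single (.merge h)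

/-! ### Preservation of well-formedness -/

/-- For environments: equal length, and the level does not increase. -/
def Shrinks : {κ : Kind} → Exp C V κ → Exp C V κ → Prop
  | .tm, _, _ => True
  | .env, e, e' => len e' = len e ∧ lev e' ≤ lev e

/-- The level can drop strictly: (m2) replaces the level `nl₁` by `lev e₁ ≤ nl₁`. This is harmless,
since well-formedness bounds levels only from above, while lengths must match exactly. -/
theorem MergeRule.wf {κ : Kind} {x x' : Exp C V κ} (h : MergeRule x x') (hx : x.WF) :
    x'.WF ∧ Shrinks x x' := by
  cases h <;> simp_all [Exp.WF, Shrinks, len, lev] <;> omega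

theorem ReadRule.wf {t t' : Tm C V} (h : ReadRule t t') (ht : t.WF) : t'.WF := by
  cases h <;> simp_all [Exp.WF, len, lev] <;> omega

theorem Step.wf {κ : Kind} {x x' : Exp C V κ} (h : Step x x') (hx : x.WF) :
    x'.WF ∧ Shrinks x x' := by
  induction h with
  | read h => exact ⟨h.wf hx, trivial⟩
  | merge h => exact h.wf hx
  | suspEnv t ol nl _ ih =>
    obtain ⟨hw, hl, hv⟩ := ih hx.2.1
    exact ⟨⟨hx.1, hw, hl.trans hx.2.2.1, hv.trans hx.2.2.2⟩, trivial⟩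
  | consTail t l _ ih =>
    obtain ⟨hw, hl, hv⟩ := ih hx.2.1
    exact ⟨⟨hx.1, hw, hv.trans hx.2.2⟩, by simp [Shrinks, len, lev, hl]⟩
  | mergeLeft nl ol e _ ih =>
    obtain ⟨hw, hl, hv⟩ := ih hx.1
    exact ⟨⟨hw, hx.2.1, hx.2.2.1, hv.trans hx.2.2.2⟩, by simp [Shrinks, len, lev, hl]⟩
  | _ => simp_all [Exp.WF, Shrinks, len, lev]

theorem Steps.wf_env {e e' : Env C V} (h : Steps e e') (he : e.WF) :
    e'.WF ∧ len e' = len e ∧ lev e' ≤ lev e := by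
  induction h with
  | refl => exact ⟨he, rfl, le_rfl⟩
  | tail _ h ih =>
    obtain ⟨hw, hl, hv⟩ := h.wf ih.1
    exact ⟨hw, hl.trans ih.2.1, hv.trans ih.2.2⟩

/-! ### Simple environments as lists -/

/-- The simple environment with the given entries. -/
def ofList : List (Tm C V × ℕ) → Env C V
  | [] => nil
  | p :: s => cons p.1 p.2 (ofList s)

/-- The level of a list of environment entries. -/
def lvl {α : Type*} : List (α × ℕ) → ℕ
  | [] => 0
  | p :: _ => p.2

@[simp] theorem len_ofList (s : List (Tm C V × ℕ)) : len (ofList s) = s.length := by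
  induction s with
  | nil => simp [ofList, len]
  | cons p s ih => simp [ofList, len, ih, add_comm]

@[simp] theorem lev_ofList (s : List (Tm C V × ℕ)) : lev (ofList s) = lvl s := by
  cases s <;> simp [ofList, lev, lvl]

theorem isSimple_ofList (s : List (Tm C V × ℕ)) : (ofList s).IsSimple := by
  induction s with
  | nil => simp [ofList, IsSimple]
  | cons p s ih => simpa [ofList, IsSimple] using ih

theorem wf_ofList_cons {p : Tm C V × ℕ} {s : List (Tm C V × ℕ)} :
    (ofList (p :: s)).WF ↔ p.1.WF ∧ (ofList s).WF ∧ lvl s ≤ p.2 := by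
  simp [ofList, Exp.WF]

/-! ### Merging simple environments -/

theorem merge_nil_steps (N : ℕ) (a : List (Tm C V × ℕ)) :
    Steps (merge nil N a.length (ofList a)) (ofList (a.drop N)) := by
  induction N generalizing a with
  | zero => exact (MergeRule.m3 _ _).steps
  | succ N ih =>
    cases a with
    | nil => exact (MergeRule.m2 _ _).steps
    | cons p a => exact (MergeRule.m4 _ _ _ _ _ (by omega)).steps.trans (ih a)

/-- Each (m5) step removes one entry of `a` and lowers `N` by one. Here `a` runs out by the time `N`
reaches `n`, so (m2) applies and (m6) never does. -/
theorem merge_cons_steps_of_drop_eq_nil (t : Tm C V) (n N : ℕ) (e : Env C V)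
    (a : List (Tm C V × ℕ)) (h : n ≤ N) (hb : a.drop (N - n) = []) :
    Steps (merge (cons t n e) N a.length (ofList a)) (cons t n e) := by
  induction a generalizing N with
  | nil => exact (MergeRule.m2 _ _).steps
  | cons p a ih =>
    obtain rfl | hN := h.eq_or_lt
    · simp at hb
    · refine (MergeRule.m5 _ _ _ _ _ _ _ _ hN).steps.trans (ih (N - 1) (by omega) ?_)
      rw [show N - n = (N - 1 - n) + 1 by omega] at hb
      simpa using hb

theorem merge_cons_steps (t : Tm C V) (n N : ℕ) (e : Env C V)
    (a b : List (Tm C V × ℕ)) (h : n ≤ N) (hb : a.drop (N - n) = b) (hb0 : b ≠ []) :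
    Steps (merge (cons t n e) N a.length (ofList a))
      (cons (susp t b.length (lvl b) (ofList b)) (lvl b + (n - b.length))
        (merge e n b.length (ofList b))) := by
  induction a generalizing N with
  | nil => simp_all
  | cons p a ih =>
    obtain rfl | hN := h.eq_or_lt
    · obtain rfl : p :: a = b := by simpa using hb
      exact (MergeRule.m6 _ _ _ _ _ _ _).steps
    · refine (MergeRule.m5 _ _ _ _ _ _ _ _ hN).steps.trans (ih (N - 1) (by omega) ?_)
      rw [show N - n = (N - 1 - n) + 1 by omega] at hb
      simpa using hb

/-- Merging the simple environments `r` and `a` can produce the simple environment `s`,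
which is `r` itself if `a` is empty. -/
def MergesTo (r : List (Tm C V × ℕ)) (N : ℕ) (a s : List (Tm C V × ℕ)) : Prop :=
  Steps (merge (ofList r) N a.length (ofList a)) (ofList s) ∧ (a = [] → s = r)

theorem MergesTo.nil (N : ℕ) (a : List (Tm C V × ℕ)) : MergesTo [] N a (a.drop N) :=
  ⟨merge_nil_steps N a, by rintro rfl; simp⟩

theorem MergesTo.cons_of_drop_eq_nil {p : Tm C V × ℕ} {N : ℕ} {e a : List (Tm C V × ℕ)}
    (h : p.2 ≤ N) (hb : a.drop (N - p.2) = []) : MergesTo (p :: e) N a (p :: e) :=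
  ⟨merge_cons_steps_of_drop_eq_nil _ _ _ _ _ h hb, fun _ => rfl⟩

theorem MergesTo.cons {t : Tm C V} {n N : ℕ} {e a b s : List (Tm C V × ℕ)}
    (h : n ≤ N) (hb : a.drop (N - n) = b) (hb0 : b ≠ []) (hs : MergesTo e n b s) :
    MergesTo ((t, n) :: e) N a
      ((susp t b.length (lvl b) (ofList b), lvl b + (n - b.length)) :: s) :=
  ⟨(merge_cons_steps t n N _ a b h hb hb0).trans (Steps.cons _ .refl hs.1), by
    rintro rfl; simp at hb; exact (hb0 hb).elim⟩

/-- When the head is already a suspension, (m1) fuses it with the suspension created by (m6), so the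
inner environment is itself merged with `b`. -/
theorem MergesTo.cons_susp {t : Tm C V} {ol m k N : ℕ} {r e a b sr s : List (Tm C V × ℕ)}
    (h : m + k ≤ N) (hb : a.drop (N - (m + k)) = b) (hr : MergesTo r m b sr)
    (hs : MergesTo e (m + k) b s) :
    MergesTo ((susp t ol m (ofList r), m + k) :: e) N a
      ((susp t (ol + (b.length - m)) (lvl b + (m - b.length)) (ofList sr),
        lvl b + (m + k - b.length)) :: s) := by
  -- If `b` is empty, (m6) does not fire and the entry is unchanged. The formula still describes it,
  -- because the length and level of `b` are `0` and the second clause of `MergesTo` gives `sr = r`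
  -- and `s = e`.
  by_cases hb0 : b = []
  · obtain rfl := hr.2 hb0
    obtain rfl := hs.2 hb0
    subst hb0
    simpa [lvl] using
      MergesTo.cons_of_drop_eq_nil (p := (susp t ol m (ofList sr), m + k)) (e := s) h hb
  · refine ⟨(merge_cons_steps _ _ N _ a b h hb hb0).trans (Steps.cons _ ?_ hs.1), ?_⟩
    · exact (MergeRule.m1 _ _ _ _ _ _ _).steps.trans (Steps.susp _ _ .refl hr.1)
    · rintro rfl; simp at hb; exact (hb0 hb).elim

/-! ### Similarity of simple environments -/

/-- Similarity of simple environments in which, hereditarily, the environments below the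
renumbered entries are simple. -/
inductive SimpleSim : List (Tm C V × ℕ) → List (Tm C V × ℕ) → Prop where
  | nil : SimpleSim [] []
  | cons {t t' : Tm C V} (n : ℕ) {e e' : List (Tm C V × ℕ)} (ht : Sim t t')
      (he : SimpleSim e e') : SimpleSim ((t, n) :: e) ((t', n) :: e')
  | renumber {t t' : Tm C V} (ol nl nl' k : ℕ) {r r' e e' : List (Tm C V × ℕ)}
      (ht : Sim t t') (hr : SimpleSim r r') (he : SimpleSim e e') :
      SimpleSim ((susp t ol nl (ofList r), nl + k) :: e)
        ((susp t' ol nl' (ofList r'), nl' + k) :: e')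

theorem SimpleSim.refl (s : List (Tm C V × ℕ)) : SimpleSim s s := by
  induction s with
  | nil => exact .nil
  | cons p s ih => exact .cons p.2 (.refl p.1) ih

theorem SimpleSim.sim {s s' : List (Tm C V × ℕ)} (h : SimpleSim s s') :
    Sim (ofList s) (ofList s') := by
  induction h with
  | nil => exact .refl _
  | cons n ht _ ih => exact .cons n ht ih
  | renumber ol nl nl' k ht _ _ ihr ihe => exact .renumber ol nl nl' k ht ihr ihe

theorem SimpleSim.length_eq {s s' : List (Tm C V × ℕ)} (h : SimpleSim s s') :
    s.length = s'.length := by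
  induction h <;> simp_all

theorem SimpleSim.drop {s s' : List (Tm C V × ℕ)} (h : SimpleSim s s') (p : ℕ) :
    SimpleSim (s.drop p) (s'.drop p) := by
  induction p generalizing s s' with
  | zero => simpa using h
  | succ p ih =>
    cases h with
    | nil => exact .nil
    | cons n ht he => exact ih he
    | renumber ol nl nl' k ht hr he => exact ih he

/-- The two runs may have different levels and suffixes, tied only by `N + p = N' + p'`. Passing to
an entry of level `n ≤ N` replaces `(N, p)` by `(n, p + (N - n))`, with the same sum. At a
renumbered entry both sums fall by the same `k` for the inner environment, so the induction
hypothesis applies to it as well. -/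
theorem SimpleSim.merge {r r' : List (Tm C V × ℕ)} (h : SimpleSim r r')
    {a a' : List (Tm C V × ℕ)} (ha : SimpleSim a a') {N N' p p' : ℕ}
    (hr : (ofList r).WF) (hr' : (ofList r').WF) (hN : lvl r ≤ N) (hN' : lvl r' ≤ N')
    (hp : N + p = N' + p') :
    ∃ s s', SimpleSim s s' ∧ MergesTo r N (a.drop p) s ∧ MergesTo r' N' (a'.drop p') s' := by
  induction h generalizing N N' p p' with
  | nil =>
    refine ⟨_, _, ?_, .nil _ _, .nil _ _⟩
    rw [List.drop_drop, List.drop_drop, add_comm p, add_comm p', hp]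
    exact ha.drop _
  | @cons t t' n e e' ht he ih =>
    rw [wf_ofList_cons] at hr hr'
    simp only [lvl] at hN hN'
    obtain ⟨s, s', hs, hm, hm'⟩ := ih (N := n) (N' := n) (p := p + (N - n))
      (p' := p' + (N' - n)) hr.2.1 hr'.2.1 hr.2.2 hr'.2.2 (by omega)
    have hq : p' + (N' - n) = p + (N - n) := by omega
    rw [hq] at hm'
    have hb := ha.drop (p + (N - n))
    have e1 : (a.drop p).drop (N - n) = a.drop (p + (N - n)) := List.drop_drop
    have e2 : (a'.drop p').drop (N' - n) = a'.drop (p + (N - n)) := by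
      rw [List.drop_drop, hq]
    generalize a.drop (p + (N - n)) = b at *
    generalize a'.drop (p + (N - n)) = b' at *
    have hlen := hb.length_eq
    by_cases hb0 : b = []
    · have hb0' : b' = [] := by
        subst hb0; exact List.eq_nil_of_length_eq_zero hlen.symm
      exact ⟨_, _, .cons n ht he, .cons_of_drop_eq_nil hN (e1.trans hb0),
        .cons_of_drop_eq_nil hN' (e2.trans hb0')⟩
    · have hb0' : b' ≠ [] := by
        rintro rfl; exact hb0 (List.eq_nil_of_length_eq_zero hlen)
      refine ⟨_, _, ?_, .cons hN e1 hb0 hm, .cons hN' e2 hb0' hm'⟩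
      rw [← hlen]
      -- The new suspensions have embedding levels `lvl b` and `lvl b'`, which may differ; the
      -- common gap is `n - b.length`.
      exact .renumber _ _ _ _ ht hb hs
  | @renumber t t' ol m m' k r r' e e' ht _ _ ihr ihe =>
    rw [wf_ofList_cons] at hr hr'
    simp only [lvl] at hN hN'
    obtain ⟨⟨_, hwr, _, hlr⟩, hwe, hle⟩ := hr
    obtain ⟨⟨_, hwr', _, hlr'⟩, hwe', hle'⟩ := hr'
    rw [lev_ofList] at hlr hlr'
    obtain ⟨sr, sr', hsr, hmr, hmr'⟩ := ihr (p := p + (N - (m + k)))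
      (p' := p' + (N' - (m' + k))) hwr hwr' hlr hlr' (by omega)
    obtain ⟨s, s', hs, hm, hm'⟩ := ihe (p := p + (N - (m + k)))
      (p' := p' + (N' - (m' + k))) hwe hwe' hle hle' (by omega)
    refine ⟨_, _, ?_, .cons_susp hN List.drop_drop hmr hm,
      .cons_susp hN' List.drop_drop hmr' hm'⟩
    have hlen := ha.length_eq
    -- The index is put in the form embedding level plus gap; `h2` and `h3` then show that the old
    -- length and the gap agree on the two sides.
    have h1 : ∀ b : List (Tm C V × ℕ), ∀ m : ℕ, lvl b + (m + k - b.length) =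
        lvl b + (m - b.length) + ((m + k - b.length) - (m - b.length)) := by
      intros; omega
    rw [h1, h1]
    have h2 : (a.drop (p + (N - (m + k)))).length - m
        = (a'.drop (p' + (N' - (m' + k)))).length - m' := by
      simp only [List.length_drop]; omega
    have h3 : m + k - (a.drop (p + (N - (m + k)))).length
          - (m - (a.drop (p + (N - (m + k)))).length)
        = m' + k - (a'.drop (p' + (N' - (m' + k)))).length
          - (m' - (a'.drop (p' + (N' - (m' + k)))).length) := by
      simp only [List.length_drop]; omega
    rw [h2, h3]
    exact .renumber _ _ _ _ ht hsr hs

/-! ### Similar simple forms of similar environments -/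

theorem SimpleSim.merge_steps {e₁ e₁' e₂ e₂' : Env C V} {r r' a a' : List (Tm C V × ℕ)}
    {N L : ℕ} (hw : (Exp.merge e₁ N L e₂).WF) (hw' : (Exp.merge e₁' N L e₂').WF)
    (h₁ : Steps e₁ (ofList r)) (h₁' : Steps e₁' (ofList r'))
    (h₂ : Steps e₂ (ofList a)) (h₂' : Steps e₂' (ofList a'))
    (hr : SimpleSim r r') (ha : SimpleSim a a') :
    ∃ s s', Steps (Exp.merge e₁ N L e₂) (ofList s) ∧
      Steps (Exp.merge e₁' N L e₂') (ofList s') ∧ SimpleSim s s' := by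
  obtain ⟨w₁, w₂, hL, hN⟩ := hw
  obtain ⟨w₁', w₂', hL', hN'⟩ := hw'
  obtain ⟨v₁, -, l₁⟩ := h₁.wf_env w₁
  obtain ⟨v₁', -, l₁'⟩ := h₁'.wf_env w₁'
  obtain ⟨-, k₂, -⟩ := h₂.wf_env w₂
  obtain ⟨-, k₂', -⟩ := h₂'.wf_env w₂'
  rw [len_ofList, hL] at k₂
  rw [len_ofList, hL'] at k₂'
  rw [lev_ofList] at l₁ l₁'
  obtain ⟨s, s', hs, hm, hm'⟩ := hr.merge ha (N := N) (N' := N) (p := 0) (p' := 0) v₁ v₁'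
    (l₁.trans hN) (l₁'.trans hN') rfl
  have hm := hm.1
  have hm' := hm'.1
  rw [List.drop_zero, k₂] at hm
  rw [List.drop_zero, k₂'] at hm'
  exact ⟨s, s', (Steps.merge _ _ h₁ h₂).trans hm, (Steps.merge _ _ h₁' h₂').trans hm', hs⟩

/-- For environments: rewriting to a simple environment is possible. -/
def Simplifies : {κ : Kind} → Exp C V κ → Prop
  | .tm, _ => True
  | .env, e => e.WF → ∃ s, Steps e (ofList s)

/-- Needed for the reflexivity clause of similarity. A merge is treated as a pair of similar merges
with equal sides. -/
theorem simplifies {κ : Kind} (x : Exp C V κ) : Simplifies x := by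
  induction x with
  | nil => exact fun _ => ⟨[], .refl⟩
  | cons t l e _ ih =>
    intro hw
    obtain ⟨s, hs⟩ := ih hw.2.1
    exact ⟨(t, l) :: s, Steps.cons _ .refl hs⟩
  | merge e₁ N L e₂ ih₁ ih₂ =>
    intro hw
    obtain ⟨r, hr⟩ := ih₁ hw.1
    obtain ⟨a, ha⟩ := ih₂ hw.2.1
    obtain ⟨s, -, hs, -⟩ :=
      SimpleSim.merge_steps hw hw hr hr ha ha (.refl r) (.refl a)
    exact ⟨s, hs⟩
  | _ => trivial

/-- For environments: rewriting to similar simple environments is possible. -/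
def SimSimplify : {κ : Kind} → Exp C V κ → Exp C V κ → Prop
  | .tm, _, _ => True
  | .env, e, e' => e.WF → e'.WF →
    ∃ s s', Steps e (ofList s) ∧ Steps e' (ofList s') ∧ SimpleSim s s'

/-- Heads of entries are not evaluated; only the environment inside a renumbered suspension is
simplified, as `SimpleSim.renumber` demands. -/
theorem Sim.simplify {κ : Kind} {x x' : Exp C V κ} (h : Sim x x') : SimSimplify x x' := by
  induction h with
  | @refl κ x =>
    cases κ with
    | tm => trivial
    | env =>
      intro hw _
      obtain ⟨s, hs⟩ := simplifies x hw
      exact ⟨s, s, hs, hs, .refl s⟩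
  | cons n ht _ _ ih =>
    intro hw hw'
    obtain ⟨s, s', hs, hs', h⟩ := ih hw.2.1 hw'.2.1
    exact ⟨_ :: s, _ :: s', Steps.cons _ .refl hs, Steps.cons _ .refl hs', .cons n ht h⟩
  | merge N L _ _ ih₁ ih₂ =>
    intro hw hw'
    obtain ⟨r, r', hr, hr', h₁⟩ := ih₁ hw.1 hw'.1
    obtain ⟨a, a', ha, ha', h₂⟩ := ih₂ hw.2.1 hw'.2.1
    exact SimpleSim.merge_steps hw hw' hr hr' ha ha' h₁ h₂
  | renumber ol nl nl' k ht _ _ _ ihr ihe =>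
    intro hw hw'
    obtain ⟨r, r', hr, hr', h₁⟩ := ihr hw.1.2.1 hw'.1.2.1
    obtain ⟨s, s', hs, hs', h₂⟩ := ihe hw.2.1 hw'.2.1
    exact ⟨(Exp.susp _ _ _ (ofList r), _) :: s, (Exp.susp _ _ _ (ofList r'), _) :: s',
      Steps.cons _ (Steps.susp _ _ .refl hr) hs, Steps.cons _ (Steps.susp _ _ .refl hr') hs',
      .renumber ol nl nl' k ht h₁ h₂⟩
  | _ => trivial

/-! ### De Bruijn terms and their simultaneous substitutions -/

/-- De Bruijn terms over the constants `C`, with indices starting at `0`. -/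
inductive DB (C : Type*) where
  | const (c : C)
  | var (i : ℕ)
  | app (t u : DB C)
  | lam (t : DB C)

namespace DB

/-- A de Bruijn term as a suspension term. -/
def toTm : DB C → Tm C V
  | const c => Exp.const c
  | var i => Exp.var i
  | app t u => Exp.app (toTm t) (toTm u)
  | lam t => Exp.lam (toTm t)

theorem isDeBruijn_toTm (d : DB C) : (d.toTm : Tm C V).IsDeBruijn := by
  induction d <;> simp_all [toTm, IsDeBruijn]

/-- The extension of a renaming under a binder. -/
def upr (f : ℕ → ℕ) : ℕ → ℕ
  | 0 => 0
  | i + 1 => f i + 1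

/-- Renaming of the free indices. -/
def ren (f : ℕ → ℕ) : DB C → DB C
  | const c => const c
  | var i => var (f i)
  | app t u => app (ren f t) (ren f u)
  | lam t => lam (ren (upr f) t)

/-- Increasing the free indices by `k`. -/
def lift (k : ℕ) (d : DB C) : DB C := ren (· + k) d

/-- The extension of a substitution under a binder. -/
def up (σ : ℕ → DB C) : ℕ → DB C
  | 0 => var 0
  | i + 1 => lift 1 (σ i)

/-- Simultaneous substitution for the free indices. -/
def inst (σ : ℕ → DB C) : DB C → DB C
  | const c => const c
  | var i => σ i
  | app t u => app (inst σ t) (inst σ u)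
  | lam t => lam (inst (up σ) t)

theorem upr_comp (f g : ℕ → ℕ) : upr f ∘ upr g = upr (f ∘ g) := by
  funext i; cases i <;> rfl

theorem ren_ren (f g : ℕ → ℕ) (d : DB C) : ren f (ren g d) = ren (f ∘ g) d := by
  induction d generalizing f g with
  | lam t ih => simp [ren, ih, upr_comp]
  | _ => simp_all [ren]

theorem lift_lift (j k : ℕ) (d : DB C) : lift j (lift k d) = lift (k + j) d := by
  simp only [lift, ren_ren]
  congr 1
  funext i
  simp [add_assoc]

@[simp] theorem lift_zero (d : DB C) : lift 0 d = d := by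
  have h : ∀ d : DB C, ren id d = d := by
    have hu : upr id = id := by funext i; cases i <;> rfl
    intro d
    induction d <;> simp_all [ren]
  exact h d

theorem ren_injective {f : ℕ → ℕ} (hf : f.Injective) :
    Function.Injective (ren f : DB C → DB C) := by
  intro d d' h
  induction d generalizing f d' with
  | const c => cases d' <;> simp_all [ren]
  | var i => cases d' <;> simp_all [ren]; exact hf h
  | app t u iht ihu =>
    cases d' <;> simp_all [ren]
    exact ⟨iht hf h.1, ihu hf h.2⟩
  | lam t ih =>
    cases d' <;> simp_all [ren]
    refine ih (f := upr f) ?_ h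
    rintro (_ | i) (_ | j) hij <;> simp_all [upr]
    exact hf hij

/-- This allows lifts to be cancelled, which makes the choice of common level in `EntryEquiv`
immaterial. -/
theorem lift_injective (k : ℕ) : Function.Injective (lift k : DB C → DB C) :=
  ren_injective fun _ _ h => by simpa using h

theorem inst_ren (σ : ℕ → DB C) (f : ℕ → ℕ) (d : DB C) :
    inst σ (ren f d) = inst (σ ∘ f) d := by
  induction d generalizing σ f with
  | lam t ih =>
    have h : up σ ∘ upr f = up (σ ∘ f) := by funext i; cases i <;> rfl
    simp [ren, inst, ih, h]
  | _ => simp_all [ren, inst]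

theorem ren_inst (f : ℕ → ℕ) (σ : ℕ → DB C) (d : DB C) :
    ren f (inst σ d) = inst (ren f ∘ σ) d := by
  induction d generalizing σ f with
  | lam t ih =>
    have h : ren (upr f) ∘ up σ = up (ren f ∘ σ) := by
      funext i
      cases i with
      | zero => rfl
      | succ i => simp only [Function.comp, up, lift, ren_ren]; rfl
    simp [ren, inst, ih, h]
  | _ => simp_all [ren, inst]

theorem inst_var (d : DB C) : inst var d = d := by
  have h : up (var : ℕ → DB C) = var := by funext i; cases i <;> rfl
  induction d <;> simp_all [inst]

end DB

/-! ### Environments of de Bruijn terms -/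

/-- The simple environment with the given de Bruijn entries, as a list. -/
def entries (s : List (DB C × ℕ)) : List (Tm C V × ℕ) := s.map fun p => (p.1.toTm, p.2)

@[simp] theorem lvl_entries (s : List (DB C × ℕ)) :
    lvl (entries s : List (Tm C V × ℕ)) = lvl s := by
  cases s <;> rfl

@[simp] theorem length_entries (s : List (DB C × ℕ)) :
    (entries s : List (Tm C V × ℕ)).length = s.length := by
  simp [entries]

theorem entries_drop (s : List (DB C × ℕ)) (k : ℕ) :
    (entries s : List (Tm C V × ℕ)).drop k = entries (s.drop k) := by
  simp [entries, List.map_drop]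

/-- The levels of the entries do not increase along the list. -/
def Descending : List (DB C × ℕ) → Prop
  | [] => True
  | p :: s => lvl s ≤ p.2 ∧ Descending s

theorem descending_of_wf {s : List (DB C × ℕ)}
    (h : (ofList (entries s : List (Tm C V × ℕ))).WF) : Descending s := by
  induction s with
  | nil => trivial
  | cons p s ih =>
    have h := wf_ofList_cons.1 h
    exact ⟨(lvl_entries s).symm.le.trans h.2.2, ih h.2.1⟩

theorem Descending.drop {s : List (DB C × ℕ)} (h : Descending s) (k : ℕ) :
    Descending (s.drop k) := by
  induction k generalizing s with
  | zero => simpa using h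
  | succ k ih => cases s with
    | nil => trivial
    | cons p s => exact ih h.2

/-- The substitution described by an environment at embedding level `nl`. -/
def look : List (DB C × ℕ) → ℕ → ℕ → DB C
  | [], nl, i => .var (i + nl)
  | p :: _, nl, 0 => p.1.lift (nl - p.2)
  | _ :: s, nl, i + 1 => look s nl i

/-- Descent together with `lvl s ≤ nl` puts every entry level below `nl`, so no subtraction `nl -
p.2` in `look` truncates. -/
theorem lift_look {s : List (DB C × ℕ)} (hs : Descending s) {nl : ℕ} (h : lvl s ≤ nl)
    (j i : ℕ) : (look s nl i).lift j = look s (nl + j) i := by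
  induction s generalizing i with
  | nil => simp [look, DB.lift, DB.ren, add_assoc]
  | cons p s ih =>
    cases i with
    | zero =>
      simp only [lvl] at h
      simp only [look, DB.lift_lift]
      congr 1
      omega
    | succ i => exact ih hs.2 (hs.1.trans h) i

theorem lift_inst_look {s : List (DB C × ℕ)} (hs : Descending s) {nl : ℕ} (h : lvl s ≤ nl)
    (j : ℕ) (d : DB C) : (d.inst (look s nl)).lift j = d.inst (look s (nl + j)) := by
  rw [DB.lift, DB.ren_inst]
  congr 1
  funext i
  exact lift_look hs h j i

/-- The entry that (r6) adds under a binder is exactly the extension of the denoted substitution. -/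
theorem up_look {s : List (DB C × ℕ)} (hs : Descending s) {nl : ℕ} (h : lvl s ≤ nl) :
    DB.up (look s nl) = look ((.var 0, nl + 1) :: s) (nl + 1) := by
  funext i
  cases i with
  | zero => simp [DB.up, look]
  | succ i => exact lift_look hs h 1 i

/-- If `q` exceeds the length of `s`, the excess `q - s.length` is an index shift that no entry
absorbs, so it moves into the level. -/
theorem look_drop (s : List (DB C × ℕ)) (q X i : ℕ) :
    look (s.drop q) (X + (q - s.length)) i = look s X (i + q) := by
  induction q generalizing s with
  | zero => simp
  | succ q ih =>
    cases s with
    | nil => simp [look]; omega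
    | cons p s => simpa [look, ← add_assoc] using ih s

theorem susp_var_steps (s : List (DB C × ℕ)) (nl i : ℕ)
    (hs : ∀ p ∈ s, ∀ k, Steps (Exp.susp p.1.toTm 0 k .nil : Tm C V) (p.1.lift k).toTm) :
    Steps (Exp.susp (Exp.var i) s.length nl (ofList (entries s)) : Tm C V)
      (look s nl i).toTm := by
  induction s generalizing i with
  | nil => exact (ReadRule.r2 _ _).steps
  | cons p s ih =>
    cases i with
    | zero => exact (ReadRule.r3 _ _ _ _ _).steps.trans (hs p (by simp) _)
    | succ i =>
      exact (ReadRule.r4 _ _ _ _ _ _).steps.trans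
        (ih i fun q hq => hs q (List.mem_cons_of_mem _ hq))

/-- Rule (r3) leaves a suspension over `nil`, so lifting the entries is assumed here. With `s` empty
the assumption is vacuous, and passing under binders adds only index entries, which (r2) lifts. This
yields `susp_nil_steps`, which then discharges the assumption for every `s`. -/
theorem susp_steps_of_lift_steps (d : DB C) (s : List (DB C × ℕ)) (nl : ℕ)
    (hd : Descending s) (hl : lvl s ≤ nl)
    (hs : ∀ p ∈ s, ∀ k, Steps (Exp.susp p.1.toTm 0 k .nil : Tm C V) (p.1.lift k).toTm) :
    Steps (Exp.susp d.toTm s.length nl (ofList (entries s)) : Tm C V)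
      (d.inst (look s nl)).toTm := by
  induction d generalizing s nl with
  | const c => exact (ReadRule.r1 _ _ _ _).steps
  | var i => exact susp_var_steps s nl i hs
  | app t u iht ihu =>
    exact (ReadRule.r5 _ _ _ _ _).steps.trans
      (Steps.app (iht s nl hd hl hs) (ihu s nl hd hl hs))
  | lam t ih =>
    refine (ReadRule.r6 _ _ _ _).steps.trans (Steps.lam ?_)
    rw [up_look hd hl]
    refine ih ((.var 0, nl + 1) :: s) (nl + 1) ⟨by simp; omega, hd⟩ le_rfl ?_
    intro p hp
    obtain rfl | hp := List.mem_cons.1 hp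
    · exact fun k => (ReadRule.r2 _ _).steps
    · exact hs p hp

theorem susp_nil_steps (d : DB C) (k : ℕ) :
    Steps (Exp.susp d.toTm 0 k .nil : Tm C V) (d.lift k).toTm := by
  have h := susp_steps_of_lift_steps (V := V) d [] k trivial (Nat.zero_le _) (by simp)
  have e : d.inst (look [] k) = d.lift k := by
    rw [DB.lift, ← DB.inst_var (d.ren _), DB.inst_ren]
    rfl
  rwa [e] at h

theorem susp_steps (d : DB C) (s : List (DB C × ℕ)) (nl : ℕ)
    (hd : Descending s) (hl : lvl s ≤ nl) :
    Steps (Exp.susp d.toTm s.length nl (ofList (entries s)) : Tm C V)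
      (d.inst (look s nl)).toTm :=
  susp_steps_of_lift_steps d s nl hd hl fun p _ k => susp_nil_steps p.1 k

theorem susp_steps_of_wf {t : Tm C V} {e : Env C V} {ol nl : ℕ} {d : DB C}
    {s : List (DB C × ℕ)} (hw : (Exp.susp t ol nl e).WF) (ht : Steps t d.toTm)
    (he : Steps e (ofList (entries s))) :
    (Descending s ∧ lvl s ≤ nl) ∧
      Steps (Exp.susp t ol nl e) (d.inst (look s nl)).toTm := by
  obtain ⟨-, hwe, rfl, hl⟩ := hw
  obtain ⟨v, k, l⟩ := he.wf_env hwe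
  have hd := descending_of_wf v
  simp only [len_ofList, lev_ofList, length_entries, lvl_entries] at k l
  have := susp_steps (V := V) d s nl hd (l.trans hl)
  rw [k] at this
  exact ⟨⟨hd, l.trans hl⟩, (Steps.susp _ _ ht he).trans this⟩

/-- The merge of two environments of de Bruijn terms. -/
def mergeDB : List (DB C × ℕ) → ℕ → List (DB C × ℕ) → List (DB C × ℕ)
  | [], N, a => a.drop N
  | p :: s, N, a =>
    (p.1.inst (look (a.drop (N - p.2)) (lvl (a.drop (N - p.2)))),
      lvl (a.drop (N - p.2)) + (p.2 - (a.drop (N - p.2)).length)) ::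
      mergeDB s p.2 (a.drop (N - p.2))

/-- An exhausted second environment denotes the identity substitution at level `0`, so `mergeDB`
needs no separate case where (m6) does not fire. -/
theorem mergeDB_nil_right (s : List (DB C × ℕ)) (N : ℕ) : mergeDB s N [] = s := by
  induction s generalizing N with
  | nil => simp [mergeDB]
  | cons p s ih =>
    have h : look ([] : List (DB C × ℕ)) 0 = .var := rfl
    simp [mergeDB, ih, lvl, h, DB.inst_var]

theorem mergeDB_steps (s a : List (DB C × ℕ)) (N : ℕ) (hs : Descending s) (hN : lvl s ≤ N)
    (ha : Descending a) :
    Steps (Exp.merge (ofList (entries s)) N a.length (ofList (entries a)) : Env C V)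
      (ofList (entries (mergeDB s N a))) := by
  induction s generalizing N a with
  | nil =>
    have := merge_nil_steps N (entries a : List (Tm C V × ℕ))
    rwa [entries_drop, length_entries] at this
  | cons p s ih =>
    by_cases hb : a.drop (N - p.2) = []
    · have := merge_cons_steps_of_drop_eq_nil (p.1.toTm : Tm C V) p.2 N (ofList (entries s))
        (entries a) hN (by rw [entries_drop, hb]; rfl)
      rw [length_entries] at this
      have h : look ([] : List (DB C × ℕ)) 0 = .var := rfl
      simpa [mergeDB, hb, mergeDB_nil_right, lvl, h, DB.inst_var, entries, ofList] using this
    · have := merge_cons_steps (p.1.toTm : Tm C V) p.2 N (ofList (entries s))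
        (entries a) (entries (a.drop (N - p.2))) hN (entries_drop _ _)
        (by simpa [entries] using hb)
      simp only [length_entries, lvl_entries] at this
      have hd := ha.drop (N - p.2)
      exact this.trans (Steps.cons _ (susp_steps _ _ _ hd le_rfl) (ih _ _ hs.2 hs.1 hd))

/-! ### Equivalence of environments of de Bruijn terms -/

/-- The terms of two environment entries agree once they are lifted to a common level. -/
def EntryEquiv (p q : DB C × ℕ) : Prop := p.1.lift q.2 = q.1.lift p.2

/-- Lifting one equation by `M` and the other by `p.2 + q.2` gives the same equation, and both lifts
are injective. -/
theorem entryEquiv_iff {p q : DB C × ℕ} {M : ℕ} (hp : p.2 ≤ M) (hq : q.2 ≤ M) :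
    EntryEquiv p q ↔ p.1.lift (M - p.2) = q.1.lift (M - q.2) := by
  rw [EntryEquiv, ← (DB.lift_injective M).eq_iff,
    ← (DB.lift_injective (p.2 + q.2)).eq_iff (a := p.1.lift _)]
  simp only [DB.lift_lift]
  rw [show M - p.2 + (p.2 + q.2) = q.2 + M by omega,
    show M - q.2 + (p.2 + q.2) = p.2 + M by omega]

/-- Pointwise equivalence of environments of de Bruijn terms. -/
abbrev EnvEquiv (s s' : List (DB C × ℕ)) : Prop := List.Forall₂ EntryEquiv s s'

theorem EnvEquiv.refl (s : List (DB C × ℕ)) : EnvEquiv s s :=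
  List.forall₂_same.2 fun _ _ => rfl

theorem EnvEquiv.drop {s s' : List (DB C × ℕ)} (h : EnvEquiv s s') (k : ℕ) :
    EnvEquiv (s.drop k) (s'.drop k) :=
  List.forall₂_drop k h

theorem EnvEquiv.look_eq {s s' : List (DB C × ℕ)} (h : EnvEquiv s s') (hs : Descending s)
    (hs' : Descending s') {nl : ℕ} (hl : lvl s ≤ nl) (hl' : lvl s' ≤ nl) :
    look s nl = look s' nl := by
  funext i
  induction h generalizing i with
  | nil => rfl
  | cons hp _ ih =>
    cases i with
    | zero => exact (entryEquiv_iff hl hl').1 hp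
    | succ i => exact ih hs.2 hs'.2 (hs.1.trans hl) (hs'.1.trans hl') i

theorem Descending.lvl_drop_le {s : List (DB C × ℕ)} (h : Descending s) (k : ℕ) :
    lvl (s.drop k) ≤ lvl s := by
  induction k generalizing s with
  | zero => simp
  | succ k ih => cases s with
    | nil => simp
    | cons p s => exact (ih h.2).trans h.1

/-- At level `M` a merged entry depends on `d`, `n` and `q` only through `d.lift q` and `n + q`. The
suffix of `a` disappears from the description, because dropping `q` entries amounts to shifting the
indices of `d` by `q`. -/
theorem lift_inst_look_drop {a : List (DB C × ℕ)} (ha : Descending a) (d : DB C)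
    {n q M : ℕ} (hM : lvl a + n + q ≤ M) :
    (d.inst (look (a.drop q) (lvl (a.drop q)))).lift
        (M - (lvl (a.drop q) + (n - (a.drop q).length))) =
      (d.lift q).inst (look a (M - (n + q - a.length))) := by
  have hl := ha.lvl_drop_le q
  rw [lift_inst_look (ha.drop q) le_rfl, DB.lift, DB.inst_ren]
  congr 1
  funext i
  rw [Function.comp, ← look_drop]
  congr 1
  rw [List.length_drop]
  omega

theorem EnvEquiv.mergeDB {s s' : List (DB C × ℕ)} (h : EnvEquiv s s')
    {a a' : List (DB C × ℕ)} (h₂ : EnvEquiv a a') (hs : Descending s) (hs' : Descending s')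
    (ha : Descending a) (ha' : Descending a') {N N' p p' : ℕ} (hN : lvl s ≤ N)
    (hN' : lvl s' ≤ N') (hp : N + p = N' + p') :
    EnvEquiv (mergeDB s N (a.drop p)) (mergeDB s' N' (a'.drop p')) := by
  induction h generalizing N N' p p' with
  | nil =>
    simp only [Susp.mergeDB, List.drop_drop]
    rw [add_comm p, add_comm p', hp]
    exact h₂.drop _
  | @cons x x' s s' hx _ ih =>
    simp only [lvl] at hN hN'
    simp only [Susp.mergeDB, List.drop_drop]
    refine .cons ?_ (ih hs.2 hs'.2 hs.1 hs'.1 (by omega))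
    have hlen := h₂.length_eq
    have hq : x.2 + (p + (N - x.2)) = x'.2 + (p' + (N' - x'.2)) := by omega
    generalize p + (N - x.2) = q at *
    generalize p' + (N' - x'.2) = q' at *
    -- A common level above both merged entries; the bound is symmetric in the two sides since `x.2
    -- + q = x'.2 + q'`.
    have hM : lvl a + x.2 + q ≤ lvl a + lvl a' + x.2 + q := by omega
    have hM' : lvl a' + x'.2 + q' ≤ lvl a + lvl a' + x.2 + q := by omega
    have hl := ha.lvl_drop_le q
    have hl' := ha'.lvl_drop_le q'
    rw [entryEquiv_iff (M := lvl a + lvl a' + x.2 + q) (by dsimp only; omega)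
      (by dsimp only; omega)]
    dsimp only
    rw [lift_inst_look_drop ha _ hM, lift_inst_look_drop ha' _ hM', ← hq, ← hlen,
      h₂.look_eq ha ha' (by omega) (by omega)]
    -- Lifting by `q` and by `q'` takes the two original entries to the same level `x.2 + q`, where
    -- their equivalence is an equality.
    have := (entryEquiv_iff (M := x.2 + q) (by omega) (by omega)).1 hx
    rw [show x.2 + q - x.2 = q by omega, show x.2 + q - x'.2 = q' by omega] at this
    rw [this]

theorem EnvEquiv.merge_steps {e₁ e₁' e₂ e₂' : Env C V} {r r' a a' : List (DB C × ℕ)}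
    {N L : ℕ} (hw : (Exp.merge e₁ N L e₂).WF) (hw' : (Exp.merge e₁' N L e₂').WF)
    (h₁ : Steps e₁ (ofList (entries r))) (h₁' : Steps e₁' (ofList (entries r')))
    (h₂ : Steps e₂ (ofList (entries a))) (h₂' : Steps e₂' (ofList (entries a')))
    (hr : EnvEquiv r r') (ha : EnvEquiv a a') :
    ∃ s s', Steps (Exp.merge e₁ N L e₂) (ofList (entries s)) ∧
      Steps (Exp.merge e₁' N L e₂') (ofList (entries s')) ∧ EnvEquiv s s' := by
  obtain ⟨w₁, w₂, hL, hN⟩ := hw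
  obtain ⟨w₁', w₂', hL', hN'⟩ := hw'
  obtain ⟨v₁, -, l₁⟩ := h₁.wf_env w₁
  obtain ⟨v₁', -, l₁'⟩ := h₁'.wf_env w₁'
  obtain ⟨v₂, k₂, -⟩ := h₂.wf_env w₂
  obtain ⟨v₂', k₂', -⟩ := h₂'.wf_env w₂'
  rw [len_ofList, length_entries, hL] at k₂
  rw [len_ofList, length_entries, hL'] at k₂'
  rw [lev_ofList, lvl_entries] at l₁ l₁'
  replace l₁ := l₁.trans hN
  replace l₁' := l₁'.trans hN'
  replace v₁ := descending_of_wf v₁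
  replace v₁' := descending_of_wf v₁'
  replace v₂ := descending_of_wf v₂
  replace v₂' := descending_of_wf v₂'
  have m := mergeDB_steps (V := V) r a N v₁ l₁ v₂
  have m' := mergeDB_steps (V := V) r' a' N v₁' l₁' v₂'
  rw [k₂] at m
  rw [k₂'] at m'
  exact ⟨_, _, (Steps.merge _ _ h₁ h₂).trans m, (Steps.merge _ _ h₁' h₂').trans m',
    by simpa using hr.mergeDB ha v₁ v₁' v₂ v₂' l₁ l₁' (p := 0) (p' := 0) rfl⟩

/-! ### Normalization of expressions without meta variables -/

/-- Rewriting to a de Bruijn term, or to a simple environment of de Bruijn terms, is possible. -/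
def Normalizes : {κ : Kind} → Exp C V κ → Prop
  | .tm, t => ∃ d : DB C, Steps t d.toTm
  | .env, e => ∃ s : List (DB C × ℕ), Steps e (ofList (entries s))

theorem normalizes {κ : Kind} (x : Exp C V κ) (hw : x.WF) (hm : x.MetaFree) :
    Normalizes x := by
  induction x with
  | mvar v => exact hm.elim
  | const c => exact ⟨.const c, .refl⟩
  | var i => exact ⟨.var i, .refl⟩
  | app t u iht ihu =>
    obtain ⟨d, hd⟩ := iht hw.1 hm.1
    obtain ⟨d', hd'⟩ := ihu hw.2 hm.2
    exact ⟨.app d d', Steps.app hd hd'⟩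
  | lam t ih =>
    obtain ⟨d, hd⟩ := ih hw hm
    exact ⟨.lam d, Steps.lam hd⟩
  | susp t ol nl e iht ihe =>
    obtain ⟨d, hd⟩ := iht hw.1 hm.1
    obtain ⟨s, hs⟩ := ihe hw.2.1 hm.2
    exact ⟨_, (susp_steps_of_wf hw hd hs).2⟩
  | nil => exact ⟨[], .refl⟩
  | cons t l e iht ihe =>
    obtain ⟨d, hd⟩ := iht hw.1 hm.1
    obtain ⟨s, hs⟩ := ihe hw.2.1 hm.2
    exact ⟨(d, l) :: s, Steps.cons _ hd hs⟩
  | merge e₁ N L e₂ ih₁ ih₂ =>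
    obtain ⟨r, hr⟩ := ih₁ hw.1 hm.1
    obtain ⟨a, ha⟩ := ih₂ hw.2.1 hm.2
    obtain ⟨s, -, hs, -⟩ := EnvEquiv.merge_steps hw hw hr hr ha ha (.refl r) (.refl a)
    exact ⟨s, hs⟩

/-- Rewriting to a common de Bruijn term, or to equivalent simple environments of de Bruijn
terms, is possible. -/
def JoinNormalize : {κ : Kind} → Exp C V κ → Exp C V κ → Prop
  | .tm, t, t' => ∃ d : DB C, Steps t d.toTm ∧ Steps t' d.toTm
  | .env, e, e' => ∃ s s' : List (DB C × ℕ),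
    Steps e (ofList (entries s)) ∧ Steps e' (ofList (entries s')) ∧ EnvEquiv s s'

theorem Sim.joinNormalize {κ : Kind} {x x' : Exp C V κ} (h : Sim x x') (hw : x.WF)
    (hw' : x'.WF) (hm : x.MetaFree) (hm' : x'.MetaFree) : JoinNormalize x x' := by
  induction h with
  | @refl κ x =>
    cases κ with
    | tm =>
      obtain ⟨d, hd⟩ := normalizes x hw hm
      exact ⟨d, hd, hd⟩
    | env =>
      obtain ⟨s, hs⟩ := normalizes x hw hm
      exact ⟨s, s, hs, hs, .refl s⟩
  | app _ _ ih₁ ih₂ =>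
    obtain ⟨d, h, h'⟩ := ih₁ hw.1 hw'.1 hm.1 hm'.1
    obtain ⟨f, k, k'⟩ := ih₂ hw.2 hw'.2 hm.2 hm'.2
    exact ⟨.app d f, Steps.app h k, Steps.app h' k'⟩
  | lam _ ih =>
    obtain ⟨d, h, h'⟩ := ih hw hw' hm hm'
    exact ⟨.lam d, Steps.lam h, Steps.lam h'⟩
  | susp ol nl _ _ iht ihe =>
    obtain ⟨d, h, h'⟩ := iht hw.1 hw'.1 hm.1 hm'.1
    obtain ⟨s, s', k, k', hs⟩ := ihe hw.2.1 hw'.2.1 hm.2 hm'.2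
    obtain ⟨⟨a, b⟩, g⟩ := susp_steps_of_wf hw h k
    obtain ⟨⟨a', b'⟩, g'⟩ := susp_steps_of_wf hw' h' k'
    rw [← hs.look_eq a a' b b'] at g'
    exact ⟨_, g, g'⟩
  | cons n _ _ iht ihe =>
    obtain ⟨d, h, h'⟩ := iht hw.1 hw'.1 hm.1 hm'.1
    obtain ⟨s, s', k, k', hs⟩ := ihe hw.2.1 hw'.2.1 hm.2 hm'.2
    exact ⟨(d, n) :: s, (d, n) :: s', Steps.cons _ h k, Steps.cons _ h' k', .cons rfl hs⟩
  | merge N L _ _ ih₁ ih₂ =>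
    obtain ⟨r, r', hr, hr', h₁⟩ := ih₁ hw.1 hw'.1 hm.1 hm'.1
    obtain ⟨a, a', ha, ha', h₂⟩ := ih₂ hw.2.1 hw'.2.1 hm.2 hm'.2
    exact EnvEquiv.merge_steps hw hw' hr hr' ha ha' h₁ h₂
  | renumber ol nl nl' k _ _ _ iht ihr ihe =>
    obtain ⟨d, h, h'⟩ := iht hw.1.1 hw'.1.1 hm.1.1 hm'.1.1
    obtain ⟨r, r', hr, hr', hrr⟩ := ihr hw.1.2.1 hw'.1.2.1 hm.1.2 hm'.1.2
    obtain ⟨s, s', hs, hs', hss⟩ := ihe hw.2.1 hw'.2.1 hm.2 hm'.2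
    obtain ⟨⟨a, b⟩, g⟩ := susp_steps_of_wf hw.1 h hr
    obtain ⟨⟨a', b'⟩, g'⟩ := susp_steps_of_wf hw'.1 h' hr'
    refine ⟨(_, nl + k) :: s, (_, nl' + k) :: s', Steps.cons _ g hs, Steps.cons _ g' hs',
      .cons ?_ hss⟩
    -- Lifting each side by the index of the other brings both embedding levels to `nl + nl' + k`,
    -- where the equivalent environments denote the same substitution.
    rw [EntryEquiv, lift_inst_look a b, lift_inst_look a' b',
      hrr.look_eq a a' (by omega) (by omega)]
    congr 2
    omega

end Susp

theorem mainTheorem9 {C V : Type*} :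
    (∀ t t' : Susp.Tm C V, t.WF → t'.WF → t.MetaFree → t'.MetaFree → Susp.Sim t t' →
      ∃ d : Susp.Tm C V, d.IsDeBruijn ∧ Susp.Steps t d ∧ Susp.Steps t' d) ∧
    (∀ e e' : Susp.Env C V, e.WF → e'.WF → Susp.Sim e e' →
      ∃ s s' : Susp.Env C V, s.IsSimple ∧ s'.IsSimple ∧
        Susp.Steps e s ∧ Susp.Steps e' s' ∧ Susp.Sim s s') := by
  refine ⟨fun t t' hw hw' hm hm' h => ?_, fun e e' hw hw' h => ?_⟩
  · obtain ⟨d, hd, hd'⟩ := h.joinNormalize hw hw' hm hm'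
    exact ⟨_, d.isDeBruijn_toTm, hd, hd'⟩
  · obtain ⟨s, s', hs, hs', hss⟩ := h.simplify hw hw'
    exact ⟨_, _, Susp.isSimple_ofList s, Susp.isSimple_ofList s', hs, hs', hss.sim⟩
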